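/- Let $\alpha>0$ and let $F$ be a continuous distribution function supported on $[1,\infty)$ whose tail $\overline F=1-F$ is regularly varying with index $-\alpha$, that is, $\lim_{t\to\infty}\overline F(tx)/\overline F(t)=x^{-\alpha}$ for every $x>0$. Let $X_1,X_2,\dots$ be independent random variables with distribution function $F$, and let $X_{1:n}\le\dots\le X_{n:n}$ be the order statistics of $X_1,\dots,X_n$. For $1\le k\le n-1$ let $$\widehat\alpha_{n,k}=\Big(\frac1k\sum_{i=1}^k\log\frac{X_{n-k+i:n}}{X_{n-k:n}}\Big)^{-1}$$ be Hill's estimator, and let $$D_{n,k}=\sup_{y\ge1}\Big|\frac1k\sum_{i=1}^k\mathbf 1_{(y,\infty)}\Big(\frac{X_{n-k+i:n}}{X_{n-k:n}}\Big)-y^{-\widehat\alpha_{n,k}}\Big|$$ be the Kolmogorov–Smirnov distance between the empirical law of the $k$ ratios and the fitted Pareto law. For $n\ge2$ let $\kappa_n^\star$ be the smallest minimizer of $k\mapsto D_{n,k}$ over $1\le k\le n-1$. Then $\kappa_n^\star\to\infty$ in probability as $n\to\infty$, that is, $\mathbb P(\kappa_n^\star\le M)\to0$ for every $M\in\mathbb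 R$. -/

import Mathlib

open Filter Topology MeasureTheory ProbabilityTheory

namespace PLFit

noncomputable section

/-- The tail `1 - F` is regularly varying at infinity with index `-α`. -/
def RegularlyVaryingTail (F : ℝ → ℝ) (α : ℝ) : Prop :=
  ∀ x : ℝ, 0 < x → Tendsto (fun t : ℝ => (1 - F (t * x)) / (1 - F t)) atTop (𝓝 (x ^ (-α)))

/-- The order statistic `x_{i:n}`, the `i`-th smallest entry of `x`, for `1 ≤ i ≤ n`
(with the value `0` for other `i`). -/
def orderStat {n : ℕ} (x : Fin n → ℝ) (i : ℕ) : ℝ :=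
  if h : 1 ≤ i ∧ i ≤ n then x (Tuple.sort x ⟨i - 1, by omega⟩) else 0

/-- `H_{n,k} = (1/k) ∑_{i=1}^k log (x_{n-k+i:n} / x_{n-k:n})`, for `1 ≤ k ≤ n - 1`. -/
def hillH {n : ℕ} (x : Fin n → ℝ) (k : ℕ) : ℝ :=
  (1 / (k : ℝ)) * ∑ i ∈ Finset.Icc 1 k,
    Real.log (orderStat x (n - k + i) / orderStat x (n - k))

/-- Hill's estimator `1 / H_{n,k}`. -/
def hillEstimator {n : ℕ} (x : Fin n → ℝ) (k : ℕ) : ℝ := (hillH x k)⁻¹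

/-- The proportion of the `k` ratios `x_{n-k+i:n} / x_{n-k:n}`, `1 ≤ i ≤ k`, that exceed `y`. -/
def empiricalTail {n : ℕ} (x : Fin n → ℝ) (k : ℕ) (y : ℝ) : ℝ :=
  (1 / (k : ℝ)) * ∑ i ∈ Finset.Icc 1 k,
    (Set.Ioi y).indicator (fun _ => (1 : ℝ)) (orderStat x (n - k + i) / orderStat x (n - k))

/-- The Kolmogorov--Smirnov distance `D_{n,k}` between the `k` ratios and the fitted Pareto law. -/
def ksDist {n : ℕ} (x : Fin n → ℝ) (k : ℕ) : ℝ :=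
  ⨆ y : Set.Ici (1 : ℝ), |empiricalTail x k (y : ℝ) - (y : ℝ) ^ (-hillEstimator x k)|

/-- The smallest minimizer of `k ↦ D_{n,k}` over `1 ≤ k ≤ n - 1` (it exists for `n ≥ 2`). -/
def kappaStar {n : ℕ} (x : Fin n → ℝ) : ℕ :=
  sInf {k : ℕ | k ∈ Finset.Icc 1 (n - 1) ∧
    ∀ j ∈ Finset.Icc 1 (n - 1), ksDist x k ≤ ksDist x j}

/-- The sequence `Y n` tends to `+∞` in probability. -/
def TendstoInProbabilityAtTop {Ω : Type*} [MeasurableSpace Ω] (P : Measure Ω)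
    (Y : ℕ → Ω → ℝ) : Prop :=
  ∀ M : ℝ, Tendsto (fun n => P {ω | Y n ω ≤ M}) atTop (𝓝 0)

end

end PLFit

/-! A law with `k` atoms of mass `1/k` cannot be closer than `1/(2k)` to a continuous one
(`ksDist_lower_bound`). So if some admissible `k` has small distance, the minimizer must be large:
`1/(2κ) ≤ D_κ ≤ D_k` (`lt_kappaStar`). It remains to make the minimal distance small with
probability tending to one.

A deterministic threshold `u` suffices for this. By regular variation, for `u` large the law of
`X/u` given `X > u` is nearly Pareto, and its mean logarithm is nearly `1/α`
(`RegularlyVaryingTail.tendsto_integral`). With `u` fixed, the strong law carries these finitely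
many approximations over to the sample (`exists_ae_eventually_paretoLikeEvent`). On that event,
taking `k` to be the number of exceedances of `u` gives `D_k ≤ 7/m` (`exists_ksDist_le`), a purely
deterministic statement. -/

namespace PLFit

/-! ### Order statistics and exceedance counts -/

section OrderStatistics

variable {n : ℕ} {x : Fin n → ℝ}

lemma orderStat_of_mem {i : ℕ} (h1 : 1 ≤ i) (h2 : i ≤ n) :
    orderStat x i = x (Tuple.sort x ⟨i - 1, by omega⟩) := by
  rw [orderStat, dif_pos ⟨h1, h2⟩]

lemma orderStat_mono {i j : ℕ} (h1 : 1 ≤ i) (hij : i ≤ j) (h2 : j ≤ n) :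
    orderStat x i ≤ orderStat x j := by
  rw [orderStat_of_mem h1 (hij.trans h2), orderStat_of_mem (h1.trans hij) h2]
  exact Tuple.monotone_sort x (Fin.mk_le_mk.2 (by omega))

lemma orderStat_pos (hx : ∀ i, 0 < x i) {i : ℕ} (h1 : 1 ≤ i) (h2 : i ≤ n) :
    0 < orderStat x i := by
  rw [orderStat_of_mem h1 h2]
  exact hx _

/-- The number of entries of `x` that exceed `z`. -/
noncomputable def exceedCount {n : ℕ} (x : Fin n → ℝ) (z : ℝ) : ℕ := (Finset.univ.filter fun i => z < x i).card

lemma exceedCount_le (z : ℝ) : exceedCount x z ≤ n := by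
  simpa [exceedCount] using Finset.card_filter_le (Finset.univ : Finset (Fin n)) fun i => z < x i

lemma exceedCount_anti {z w : ℝ} (h : z ≤ w) : exceedCount x w ≤ exceedCount x z :=
  Finset.card_le_card fun i hi => by
    simp only [Finset.mem_filter, Finset.mem_univ, true_and] at hi ⊢
    exact h.trans_lt hi

lemma exceedCount_eq_sum (z : ℝ) :
    (exceedCount x z : ℝ) = ∑ i, (Set.Ioi z).indicator (fun _ => (1 : ℝ)) (x i) := by
  simp [exceedCount, Set.indicator_apply]

lemma orderStat_le_iff {i : ℕ} (h1 : 1 ≤ i) (h2 : i ≤ n) (z : ℝ) :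
    orderStat x i ≤ z ↔ i ≤ n - exceedCount x z := by
  rw [orderStat_of_mem h1 h2]
  have key := Tuple.lt_card_le_iff_apply_le_of_monotone (f := x ∘ Tuple.sort x) (a := z)
    (Tuple.monotone_sort x) (j := ⟨i - 1, by omega⟩)
  have hc : (Finset.univ.filter fun j => (x ∘ Tuple.sort x) j ≤ z).card =
      n - exceedCount x z := by
    rw [Finset.card_equiv (t := Finset.univ.filter fun j => x j ≤ z) (Tuple.sort x) (by simp)]
    have := Finset.card_filter_add_card_filter_not (s := (Finset.univ : Finset (Fin n)))
      (fun i => z < x i)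
    simp only [not_lt, Finset.card_univ, Fintype.card_fin] at this
    rw [exceedCount]
    omega
  rw [hc] at key
  rw [← Function.comp_apply (f := x), ← key]
  simp only
  omega

/-- Turns sums over the top `k` order statistics into sums over the unsorted sample, to which the
law of large numbers applies. -/
lemma sum_orderStat_top {k : ℕ} (hk : k ≤ n) (φ : ℝ → ℝ)
    (h : ∀ i, 1 ≤ i → i ≤ n - k → φ (orderStat x i) = 0) :
    ∑ i ∈ Finset.Icc 1 k, φ (orderStat x (n - k + i)) = ∑ i, φ (x i) := by
  have h1 : ∑ i, φ (x i) = ∑ i ∈ Finset.range n, φ (orderStat x (i + 1)) := by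
    rw [← Equiv.sum_comp (Tuple.sort x), Finset.sum_range]
    refine Finset.sum_congr rfl fun i _ => ?_
    rw [orderStat_of_mem (by omega) (by omega)]
    rfl
  have h2 : ∑ i ∈ Finset.range n, φ (orderStat x (i + 1)) =
      ∑ i ∈ Finset.range (n - k + k), φ (orderStat x (i + 1)) := by
    rw [Nat.sub_add_cancel hk]
  have h3 : ∑ i ∈ Finset.range (n - k), φ (orderStat x (i + 1)) = 0 :=
    Finset.sum_eq_zero fun i hi => h _ (by omega) (by rw [Finset.mem_range] at hi; omega)
  rw [h1, h2, Finset.sum_range_add, h3, zero_add, Finset.range_eq_Ico]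
  exact (Finset.sum_Ico_add' (fun i => φ (orderStat x (n - k + i))) 0 k 1).symm

end OrderStatistics

/-! ### The lower bound on the distance, and its effect on the minimizer -/

section LowerBound

variable {n : ℕ} {x : Fin n → ℝ} {k : ℕ}

lemma one_le_ratio (hx : ∀ i, 0 < x i) (hk : k ∈ Finset.Icc 1 (n - 1)) {i : ℕ}
    (hi : i ∈ Finset.Icc 1 k) : 1 ≤ orderStat x (n - k + i) / orderStat x (n - k) := by
  rw [Finset.mem_Icc] at hk hi
  rw [one_le_div (orderStat_pos hx (by omega) (by omega))]
  exact orderStat_mono (by omega) (by omega) (by omega)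

lemma hillEstimator_nonneg (hx : ∀ i, 0 < x i) (hk : k ∈ Finset.Icc 1 (n - 1)) :
    0 ≤ hillEstimator x k :=
  inv_nonneg.2 <| mul_nonneg (by positivity) <|
    Finset.sum_nonneg fun _ hi => Real.log_nonneg (one_le_ratio hx hk hi)

lemma empiricalTail_nonneg (y : ℝ) : 0 ≤ empiricalTail x k y :=
  mul_nonneg (by positivity) <| Finset.sum_nonneg fun _ _ =>
    Set.indicator_nonneg (fun _ _ => zero_le_one) _

lemma empiricalTail_le_one (y : ℝ) : empiricalTail x k y ≤ 1 := by
  have h : ∑ i ∈ Finset.Icc 1 k,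
      (Set.Ioi y).indicator (fun _ => (1 : ℝ)) (orderStat x (n - k + i) / orderStat x (n - k))
      ≤ k := by
    refine (Finset.sum_le_card_nsmul _ _ 1 fun i _ => ?_).trans (by simp)
    exact Set.indicator_le_self' (fun _ _ => zero_le_one) _
  rw [empiricalTail, one_div_mul_eq_div]
  exact div_le_one_of_le₀ h (by positivity)

/-- Both tails lie in `[0, 1]`, so the real supremum is over a bounded family. -/
lemma le_ksDist (hx : ∀ i, 0 < x i) (hk : k ∈ Finset.Icc 1 (n - 1)) {y : ℝ} (hy : 1 ≤ y) :
    |empiricalTail x k y - y ^ (-hillEstimator x k)| ≤ ksDist x k := by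
  refine le_ciSup (f := fun y : Set.Ici (1 : ℝ) =>
    |empiricalTail x k (y : ℝ) - (y : ℝ) ^ (-hillEstimator x k)|) ⟨1, ?_⟩ ⟨y, hy⟩
  rintro _ ⟨⟨z, hz⟩, rfl⟩
  have hz1 : (1 : ℝ) ≤ z := hz
  have h1 := Real.rpow_le_one_of_one_le_of_nonpos hz1
    (neg_nonpos.2 (hillEstimator_nonneg hx hk))
  have h2 : 0 ≤ z ^ (-hillEstimator x k) := by positivity
  have h3 := empiricalTail_nonneg (x := x) (k := k) z
  have h4 := empiricalTail_le_one (x := x) (k := k) z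
  exact abs_le.2 ⟨by simp only; linarith, by simp only; linarith⟩

/-- A law with `k` atoms of mass `1/k` is at Kolmogorov--Smirnov distance at least `1/(2k)` from a
continuous one. -/
lemma ksDist_lower_bound (hx : ∀ i, 0 < x i) (hk : k ∈ Finset.Icc 1 (n - 1)) :
    1 / (2 * (k : ℝ)) ≤ ksDist x k := by
  have hk' := Finset.mem_Icc.1 hk
  have hk0 : (0 : ℝ) < k := by exact_mod_cast hk'.1
  set r := orderStat x n / orderStat x (n - k) with hr
  have hv : 0 < orderStat x (n - k) := orderStat_pos hx (by omega) (by omega)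
  have hmax : ∀ i ∈ Finset.Icc 1 k, orderStat x (n - k + i) / orderStat x (n - k) ≤ r := by
    intro i hi
    rw [Finset.mem_Icc] at hi
    exact div_le_div_of_nonneg_right (orderStat_mono (by omega) (by omega) le_rfl) hv.le
  have hkk : n - k + k = n := by omega
  have hr1 : 1 ≤ r := by
    have := one_le_ratio hx hk (Finset.mem_Icc.2 ⟨hk'.1, le_rfl⟩)
    rwa [hkk] at this
  have hzero : empiricalTail x k r = 0 := by
    rw [empiricalTail, Finset.sum_eq_zero, mul_zero]
    intro i hi
    exact Set.indicator_of_notMem (by simpa using hmax i hi) _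
  have hupper := le_ksDist hx hk hr1
  rw [hzero, zero_sub, abs_neg, abs_of_nonneg (by positivity)] at hupper
  -- If `r = 1` the discrepancy at `1` is already `1`. Otherwise the empirical tail falls from at
  -- least `1/k` to `0` at `r`; with `a` the fitted value there, both `a` and the left limit `1/k -
  -- a` are bounded by the distance, and they sum to `1/k`.
  rcases hr1.eq_or_lt with h | h
  · rw [← h, Real.one_rpow] at hupper
    refine le_trans ?_ hupper
    rw [div_le_one (by positivity)]
    have : (1 : ℝ) ≤ k := by exact_mod_cast hk'.1
    linarith
  · have hlow : ∀ y ∈ Set.Ico 1 r, 1 / (k : ℝ) - y ^ (-hillEstimator x k) ≤ ksDist x k := by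
      intro y hy
      have h1 : 1 / (k : ℝ) ≤ empiricalTail x k y := by
        rw [empiricalTail]
        refine le_mul_of_one_le_right (by positivity) ?_
        have := Finset.single_le_sum (f := fun i => (Set.Ioi y).indicator (fun _ => (1 : ℝ))
          (orderStat x (n - k + i) / orderStat x (n - k)))
          (fun i _ => Set.indicator_nonneg (fun _ _ => zero_le_one) _)
          (Finset.mem_Icc.2 ⟨hk'.1, le_refl k⟩)
        refine le_trans ?_ this
        simp only [hkk]
        rw [Set.indicator_of_mem]
        exact hy.2
      have := (le_abs_self _).trans (le_ksDist hx hk hy.1)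
      linarith
    have hlim : Tendsto (fun y : ℝ => 1 / (k : ℝ) - y ^ (-hillEstimator x k)) (𝓝[<] r)
        (𝓝 (1 / (k : ℝ) - r ^ (-hillEstimator x k))) :=
      ((Real.continuousAt_rpow_const r _ (Or.inl (by positivity))).tendsto.mono_left
        nhdsWithin_le_nhds).const_sub _
    have hle := le_of_tendsto hlim (by
      filter_upwards [Ico_mem_nhdsLT h] with y hy using hlow y hy)
    have : 1 / (2 * (k : ℝ)) = 1 / (k : ℝ) / 2 := by ring
    rw [this]
    linarith

lemma kappaStar_mem (hn : 2 ≤ n) (x : Fin n → ℝ) :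
    kappaStar x ∈ Finset.Icc 1 (n - 1) ∧
      ∀ j ∈ Finset.Icc 1 (n - 1), ksDist x (kappaStar x) ≤ ksDist x j := by
  obtain ⟨k, hk⟩ := Finset.exists_min_image (Finset.Icc 1 (n - 1)) (ksDist x)
    ⟨1, Finset.mem_Icc.2 ⟨le_rfl, by omega⟩⟩
  exact Nat.sInf_mem (s := {k : ℕ | k ∈ Finset.Icc 1 (n - 1) ∧
    ∀ j ∈ Finset.Icc 1 (n - 1), ksDist x k ≤ ksDist x j}) ⟨k, hk⟩

lemma lt_kappaStar (hx : ∀ i, 0 < x i) (hk : k ∈ Finset.Icc 1 (n - 1)) {M : ℝ} (hM : 0 < M)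
    (h : ksDist x k < 1 / (2 * M)) : M < kappaStar x := by
  obtain ⟨hmem, hmin⟩ := kappaStar_mem (by rw [Finset.mem_Icc] at hk; omega) x
  have h1 := ksDist_lower_bound hx hmem
  have h2 := hmin k hk
  have h0 : (0 : ℝ) < kappaStar x := by exact_mod_cast (Finset.mem_Icc.1 hmem).1
  have h3 : 1 / (2 * (kappaStar x : ℝ)) < 1 / (2 * M) := by linarith
  have h4 := lt_of_one_div_lt_one_div (by positivity) h3
  linarith

end LowerBound

/-! ### A small distance for Pareto-like exceedances -/

section UpperBound

/-- A monotone function that is close to the identity on a grid is close to it everywhere. -/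
lemma abs_sub_le_of_grid {g : ℝ → ℝ} {m : ℕ} (hm : 0 < m)
    (hmono : ∀ s t, 0 < s → s ≤ t → g s ≤ g t) (h0 : ∀ s, 0 ≤ g s)
    (hgrid : ∀ j ∈ Finset.Icc 1 (2 * m), |g ((j : ℝ) / m) - (j : ℝ) / m| < 1 / m)
    {s : ℝ} (hs0 : 0 < s) (hs : s < 2) : |g s - s| ≤ 2 / m := by
  have hm' : (0 : ℝ) < m := by exact_mod_cast hm
  set j := ⌊s * m⌋₊ with hj
  have hj1 : (j : ℝ) ≤ s * m := Nat.floor_le (by positivity)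
  have hj2 : s * m < j + 1 := Nat.lt_floor_add_one _
  have hjm : j < 2 * m := by
    have : (j : ℝ) < (2 * m : ℕ) := by push_cast; nlinarith
    exact_mod_cast this
  have hle : (j : ℝ) / m ≤ s := by rwa [div_le_iff₀ hm']
  have hge : s ≤ ((j + 1 : ℕ) : ℝ) / m := by
    rw [le_div_iff₀ hm']; push_cast; exact hj2.le
  have hstep : ((j + 1 : ℕ) : ℝ) / m = (j : ℝ) / m + 1 / m := by push_cast; ring
  have h2 : (2 : ℝ) / m = 1 / m + 1 / m := by ring
  have hup := abs_lt.1 (hgrid (j + 1) (Finset.mem_Icc.2 ⟨by omega, by omega⟩))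
  have hup' := hmono _ _ hs0 hge
  rw [abs_le]
  refine ⟨?_, by linarith [hup.2]⟩
  -- Below the first grid point, nonnegativity of `g` replaces the missing lower neighbour.
  rcases Nat.eq_zero_or_pos j with hj0 | hj0
  · rw [hj0, zero_add, Nat.cast_one] at hge
    have : (0 : ℝ) < 1 / m := by positivity
    have := h0 s
    linarith
  · have hlo := abs_lt.1 (hgrid j (Finset.mem_Icc.2 ⟨hj0, by omega⟩))
    have hjp : (0 : ℝ) < j := by exact_mod_cast hj0
    have hlo' := hmono _ _ (by positivity) hle
    linarith [hlo.1]

/-- Factor out `y ^ (-a)` and use `1 - e^{-z} ≤ z`; then `w e^{-w} ≤ 1` with `w = a log y` makes the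
bound uniform in `y`. -/
lemma abs_rpow_neg_sub_le {a b y : ℝ} (ha : 0 < a) (hab : a ≤ b) (hy : 1 ≤ y) :
    |y ^ (-a) - y ^ (-b)| ≤ b / a - 1 := by
  have hy0 : 0 < y := by linarith
  have hL : 0 ≤ Real.log y := Real.log_nonneg hy
  rw [abs_of_nonneg (sub_nonneg.2 (Real.rpow_le_rpow_of_exponent_le hy (neg_le_neg hab))),
    Real.rpow_def_of_pos hy0, Real.rpow_def_of_pos hy0]
  set L := Real.log y
  have h1 : Real.exp (L * -b) = Real.exp (L * -a) * Real.exp (-((b - a) * L)) := by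
    rw [← Real.exp_add]; ring_nf
  have h2 := Real.add_one_le_exp (-((b - a) * L))
  have h3 : Real.exp (L * -a) * (a * L) ≤ 1 := by
    have h4 := Real.add_one_le_exp (a * L)
    have h5 : Real.exp (L * -a) * Real.exp (a * L) = 1 := by
      rw [← Real.exp_add]; ring_nf; exact Real.exp_zero
    nlinarith [Real.exp_pos (L * -a)]
  have h6 : b / a - 1 = (b - a) / a := by field_simp
  rw [h6, le_div_iff₀ ha, h1]
  have h7 : 0 ≤ b - a := by linarith
  have h8 := Real.exp_pos (L * -a)
  calc (Real.exp (L * -a) - Real.exp (L * -a) * Real.exp (-((b - a) * L))) * a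
      = Real.exp (L * -a) * (1 - Real.exp (-((b - a) * L))) * a := by ring
    _ ≤ Real.exp (L * -a) * ((b - a) * L) * a := by gcongr; linarith
    _ = (Real.exp (L * -a) * (a * L)) * (b - a) := by ring
    _ ≤ 1 * (b - a) := by gcongr
    _ = b - a := one_mul _

variable {n : ℕ} {x : Fin n → ℝ} {u y : ℝ}

lemma orderStat_threshold_le (hK : exceedCount x u < n) :
    orderStat x (n - exceedCount x u) ≤ u :=
  (orderStat_le_iff (by omega) (by omega) u).2 le_rfl

lemma lt_orderStat_threshold {i : ℕ} (hi : i ∈ Finset.Icc 1 (exceedCount x u)) :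
    u < orderStat x (n - exceedCount x u + i) := by
  have := exceedCount_le (x := x) u
  rw [Finset.mem_Icc] at hi
  rw [← not_le, orderStat_le_iff (by omega) (by omega)]
  omega

lemma empiricalTail_eq (hx : ∀ i, 0 < x i) (hK : exceedCount x u < n) (hy : 1 ≤ y) :
    empiricalTail x (exceedCount x u) y =
      exceedCount x (orderStat x (n - exceedCount x u) * y) / exceedCount x u := by
  set K := exceedCount x u
  have hv : 0 < orderStat x (n - K) := orderStat_pos hx (by omega) (by omega)
  set v := orderStat x (n - K)
  rw [exceedCount_eq_sum, empiricalTail, one_div_mul_eq_div,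
    ← sum_orderStat_top (k := K) hK.le]
  · congr 1
    refine Finset.sum_congr rfl fun i _ => ?_
    have : y < orderStat x (n - K + i) / v ↔ v * y < orderStat x (n - K + i) := by
      rw [lt_div_iff₀ hv, mul_comm]
    simp only [Set.indicator_apply, Set.mem_Ioi]
    exact if_congr this rfl rfl
  · intro i hi1 hi2
    refine Set.indicator_of_notMem ?_ _
    rw [Set.mem_Ioi, not_lt]
    have : orderStat x i ≤ v := orderStat_mono hi1 hi2 (by omega)
    nlinarith

/-- Replaces the random threshold by `u`: each logarithm splits as `log (X/u) + log (u/v)`, and the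
positive part removes the observations not exceeding `u`. -/
lemma hillH_eq (hx : ∀ i, 0 < x i) (hu : 0 < u) (hK0 : 0 < exceedCount x u)
    (hK : exceedCount x u < n) :
    hillH x (exceedCount x u) = (∑ i, max 0 (Real.log (x i / u))) / exceedCount x u +
      Real.log (u / orderStat x (n - exceedCount x u)) := by
  have hgt := fun i => lt_orderStat_threshold (x := x) (u := u) (i := i)
  have hlow := orderStat_threshold_le hK
  set K := exceedCount x u
  have hv : 0 < orderStat x (n - K) := orderStat_pos hx (by omega) (by omega)
  set v := orderStat x (n - K)
  have hK0' : (K : ℝ) ≠ 0 := by exact_mod_cast hK0.ne'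
  rw [hillH, one_div_mul_eq_div, ← sum_orderStat_top (k := K) hK.le
    (fun w => max 0 (Real.log (w / u)))]
  · rw [div_add' _ _ _ hK0']
    congr 1
    have : Real.log (u / v) * K = ∑ i ∈ Finset.Icc 1 K, Real.log (u / v) := by
      simp [mul_comm]
    rw [this, ← Finset.sum_add_distrib]
    refine Finset.sum_congr rfl fun i hi => ?_
    have hi' := hgt i hi
    rw [max_eq_right (Real.log_nonneg ((one_le_div hu).2 hi'.le)),
      ← Real.log_mul (div_pos (hu.trans hi') hu).ne' (div_pos hu hv).ne',
      div_mul_div_cancel₀ hu.ne']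
  · intro i hi1 hi2
    have h1 : orderStat x i ≤ v := orderStat_mono hi1 hi2 (by omega)
    have h2 : 0 < orderStat x i := orderStat_pos hx hi1 (by omega)
    exact max_eq_left (Real.log_nonpos (by positivity) ((div_le_one hu).2 (h1.trans hlow)))

/-- If the exceedances over a threshold `u` look like a Pareto sample, then their number is an
admissible `k` with a small Kolmogorov--Smirnov distance. -/
lemma exists_ksDist_le {α : ℝ} (hα : 0 < α) (hx : ∀ i, 0 < x i) (hu : 0 < u) {m : ℕ} (hm : 4 ≤ m)
    (hgrid : ∀ j ∈ Finset.Icc 1 (2 * m),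
      |(exceedCount x (u * ((j : ℝ) / m) ^ (-α⁻¹)) : ℝ) / exceedCount x u - (j : ℝ) / m| < 1 / m)
    (hlog : |(∑ i, max 0 (Real.log (x i / u))) / exceedCount x u - 1 / α| < 1 / (m * α)) :
    ∃ k ∈ Finset.Icc 1 (n - 1), ksDist x k ≤ 7 / m := by
  have hm' : (4 : ℝ) ≤ m := by exact_mod_cast hm
  have hm0 : (0 : ℝ) < m := by linarith
  have hm1 : 1 / (m : ℝ) ≤ 1 / 4 := by gcongr
  have hm1' : 0 < 1 / (m : ℝ) := by positivity
  -- With no exceedances the quotient is `0` by convention, contradicting the grid bound at `j = m`.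
  have hK0 : 0 < exceedCount x u := by
    by_contra h
    have h1 := hgrid m (Finset.mem_Icc.2 ⟨by omega, by omega⟩)
    rw [Nat.eq_zero_of_not_pos h, div_self hm0.ne'] at h1
    norm_num at h1
    rw [one_div] at hm1
    linarith
  have hK0' : (0 : ℝ) < exceedCount x u := by exact_mod_cast hK0
  -- The grid point `j = m + 1` forces an observation just below `u`. This gives `K < n` and keeps
  -- the order statistic `v` close to `u`.
  have hgrid1 := (abs_lt.1 (hgrid (m + 1) (Finset.mem_Icc.2 ⟨by omega, by omega⟩))).1
  have hstep : ((m + 1 : ℕ) : ℝ) / m = 1 + 1 / m := by push_cast; field_simp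
  rw [hstep] at hgrid1
  have hlt : exceedCount x u < exceedCount x (u * (1 + 1 / (m : ℝ)) ^ (-α⁻¹)) := by
    have h1 : (1 : ℝ) < (exceedCount x (u * (1 + 1 / (m : ℝ)) ^ (-α⁻¹)) : ℝ) /
      exceedCount x u := by linarith
    rw [one_lt_div hK0'] at h1
    exact_mod_cast h1
  have hK : exceedCount x u < n := hlt.trans_le (exceedCount_le _)
  have hvu := orderStat_threshold_le hK
  have hvlow : u * (1 + 1 / (m : ℝ)) ^ (-α⁻¹) < orderStat x (n - exceedCount x u) := by
    by_contra! h
    rw [orderStat_le_iff (by omega) (by omega)] at h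
    have := exceedCount_le (x := x) (u * (1 + 1 / (m : ℝ)) ^ (-α⁻¹))
    omega
  have htail := fun y => empiricalTail_eq (y := y) hx hK
  have hhill := hillH_eq hx hu hK0 hK
  set K := exceedCount x u with hKdef
  have hv : 0 < orderStat x (n - K) := orderStat_pos hx (by omega) (by omega)
  set v := orderStat x (n - K)
  refine ⟨K, Finset.mem_Icc.2 ⟨hK0, by omega⟩, ?_⟩
  set ρ := (v / u) ^ (-α) with hρ
  have hρ1 : 1 ≤ ρ :=
    Real.one_le_rpow_of_pos_of_le_one_of_nonpos (by positivity) ((div_le_one hu).2 hvu)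
      (by linarith)
  have hρ2 : ρ ≤ 1 + 1 / m := by
    have h1 : (1 + 1 / (m : ℝ)) ^ (-α⁻¹) ≤ v / u := by
      rw [le_div_iff₀ hu, mul_comm]; exact hvlow.le
    have h2 := Real.rpow_le_rpow_of_nonpos (by positivity) h1 (by linarith : -α ≤ 0)
    rwa [← Real.rpow_mul (by positivity), neg_mul_neg, inv_mul_cancel₀ hα.ne',
      Real.rpow_one] at h2
  have hloguv : Real.log (u / v) * α = Real.log ρ := by
    rw [hρ, Real.log_rpow (by positivity), ← inv_div v u, Real.log_inv]
    ring
  have hH : |hillH x K * α - 1| ≤ 2 / m := by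
    have h1 : 0 ≤ Real.log ρ := Real.log_nonneg hρ1
    have h2 : Real.log ρ ≤ 1 / m :=
      (Real.log_le_sub_one_of_pos (by linarith)).trans (by linarith)
    have h3 : |((∑ i, max 0 (Real.log (x i / u))) / K - 1 / α) * α| ≤ 1 / m := by
      rw [abs_mul, abs_of_pos hα, ← le_div_iff₀ hα, div_div]
      exact hlog.le
    have h4 : hillH x K * α - 1 =
        ((∑ i, max 0 (Real.log (x i / u))) / K - 1 / α) * α + Real.log ρ := by
      rw [hhill, add_mul, hloguv, sub_mul, one_div_mul_cancel hα.ne']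
      ring
    have h5 : (2 : ℝ) / m = 1 / m + 1 / m := by ring
    rw [h4, abs_le]
    rw [abs_le] at h3
    constructor <;> linarith [h3.1, h3.2]
  have h2m : (2 : ℝ) / m ≤ 1 / 2 := by
    have : (2 : ℝ) / m = 2 * (1 / m) := by ring
    linarith
  have hHpos : 0 < hillH x K * α := by linarith [(abs_le.1 hH).1]
  have hHpos' : 0 < hillH x K := pos_of_mul_pos_left hHpos hα.le
  -- With `δ = 2/m ≤ 1/2`, the relative error of the exponent is at most `δ` or `1/(1 - δ) - 1 ≤
  -- 2δ`.
  have hpow : ∀ y : ℝ, 1 ≤ y → |y ^ (-hillEstimator x K) - y ^ (-α)| ≤ 4 / m := by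
    intro y hy
    have ha : 0 < hillEstimator x K := inv_pos.2 hHpos'
    have h4m : (4 : ℝ) / m = 2 * (2 / m) := by ring
    have h0m : (0 : ℝ) < 2 / m := by positivity
    rcases le_total (hillEstimator x K) α with h | h
    · refine (abs_rpow_neg_sub_le ha h hy).trans ?_
      rw [hillEstimator, div_inv_eq_mul, mul_comm]
      linarith [(abs_le.1 hH).2]
    · rw [abs_sub_comm]
      refine (abs_rpow_neg_sub_le hα h hy).trans ?_
      rw [hillEstimator, ← one_div, div_div, sub_le_iff_le_add, div_le_iff₀ hHpos, h4m]
      nlinarith [(abs_le.1 hH).1]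
  have hemp : ∀ y : ℝ, 1 ≤ y → |empiricalTail x K y - y ^ (-α)| ≤ 3 / m := by
    intro y hy
    have hy0 : 0 < y := by linarith
    rw [htail y hy]
    have hy1 : y ^ (-α) ≤ 1 := Real.rpow_le_one_of_one_le_of_nonpos hy (by linarith)
    have hy2 : 0 < y ^ (-α) := by positivity
    -- Chosen so that `u * s ^ (-α⁻¹) = v * y`. Since `s` can exceed `1` by up to `1/m`, the grid
    -- has to extend beyond `1`.
    set s := y ^ (-α) * ρ with hs
    have hs0 : 0 < s := by positivity
    have hs2 : s ≤ y ^ (-α) + 1 / m := by nlinarith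
    have hs1 : y ^ (-α) ≤ s := le_mul_of_one_le_right hy2.le hρ1
    have hsv : u * s ^ (-α⁻¹) = v * y := by
      rw [hs, hρ, ← Real.mul_rpow hy0.le (by positivity), ← Real.rpow_mul (by positivity),
        neg_mul_neg, mul_inv_cancel₀ hα.ne', Real.rpow_one]
      field_simp
    have key := abs_sub_le_of_grid (g := fun s => (exceedCount x (u * s ^ (-α⁻¹)) : ℝ) / K)
      (m := m) (by omega) ?_ (fun s => by positivity) hgrid hs0 (by linarith)
    · simp only [hsv] at key
      have h3 : (3 : ℝ) / m = 2 / m + 1 / m := by ring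
      rw [abs_le] at key ⊢
      constructor <;> linarith [key.1, key.2]
    · intro a b ha hab
      have : exceedCount x (u * a ^ (-α⁻¹)) ≤ exceedCount x (u * b ^ (-α⁻¹)) := by
        refine exceedCount_anti (mul_le_mul_of_nonneg_left ?_ hu.le)
        exact Real.rpow_le_rpow_of_nonpos ha hab (neg_nonpos.2 (inv_nonneg.2 hα.le))
      gcongr
  have : Nonempty (Set.Ici (1 : ℝ)) := ⟨⟨1, le_refl (1 : ℝ)⟩⟩
  refine ciSup_le fun ⟨y, hy⟩ => ?_
  have h7 : (7 : ℝ) / m = 3 / m + 4 / m := by ring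
  rw [h7]
  refine (abs_sub_le _ (y ^ (-α)) _).trans (add_le_add (hemp y hy) ?_)
  rw [abs_sub_comm]
  exact hpow y hy

end UpperBound

/-! ### Regular variation: Potter bound and mean log-excess -/

section RegularVariation

variable {F : ℝ → ℝ} {α : ℝ}

/-- A tail that vanishes somewhere vanishes from there on, so the ratio at `x = 1` becomes `0 / 0 =
0` instead of tending to `1`. -/
lemma RegularlyVaryingTail.tail_pos (hRV : RegularlyVaryingTail F α) (hmono : Monotone F)
    (hle : ∀ x, F x ≤ 1) (u : ℝ) : 0 < 1 - F u := by
  by_contra h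
  have hu : F u = 1 := le_antisymm (hle u) (by linarith)
  have h1 := hRV 1 one_pos
  rw [Real.one_rpow] at h1
  have h2 : Tendsto (fun t : ℝ => (1 - F (t * 1)) / (1 - F t)) atTop (𝓝 0) := by
    refine tendsto_const_nhds.congr' ?_
    filter_upwards [eventually_ge_atTop u] with t ht
    have : F t = 1 := le_antisymm (hle t) (hu ▸ hmono ht)
    simp [this]
  exact one_ne_zero (tendsto_nhds_unique h1 h2)

/-- A weak form of Potter's bound. -/
lemma RegularlyVaryingTail.tail_exp_le (hRV : RegularlyVaryingTail F α) (hmono : Monotone F)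
    (hle : ∀ x, F x ≤ 1) (hα : 0 < α) :
    ∀ᶠ u in atTop, ∀ t : ℝ, 0 ≤ t →
      (1 - F (u * Real.exp t)) / (1 - F u) ≤ Real.exp (α / 2) * Real.exp (-(α / 2) * t) := by
  have hpos := hRV.tail_pos hmono hle
  -- One step by a factor `e` eventually gains `e^{-α/2}`, as the limit is `e^{-α}`. Iterate over
  -- integers; the factor `e^{α/2}` pays for rounding `t` down.
  have h1 := hRV (Real.exp 1) (Real.exp_pos 1)
  rw [← Real.exp_mul, one_mul] at h1
  have hlt : Real.exp (-α) < Real.exp (-(α / 2)) := Real.exp_lt_exp.2 (by linarith)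
  obtain ⟨u₀, hu₀⟩ := eventually_atTop.1 (h1.eventually_lt_const hlt)
  filter_upwards [eventually_ge_atTop u₀, eventually_ge_atTop 1] with u hu hu1 t ht
  have hstep : ∀ j : ℕ, 1 - F (u * Real.exp j) ≤ Real.exp (-(α / 2) * j) * (1 - F u) := by
    intro j
    induction j with
    | zero => simp
    | succ j ih =>
      have he : 1 ≤ Real.exp j := Real.one_le_exp (by positivity)
      have h2 := hu₀ (u * Real.exp j) (hu.trans (le_mul_of_one_le_right (by linarith) he))
      rw [div_lt_iff₀ (hpos _), mul_assoc, ← Real.exp_add] at h2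
      push_cast
      calc 1 - F (u * Real.exp (j + 1))
          ≤ Real.exp (-(α / 2)) * (1 - F (u * Real.exp j)) := h2.le
        _ ≤ Real.exp (-(α / 2)) * (Real.exp (-(α / 2) * j) * (1 - F u)) := by gcongr
        _ = Real.exp (-(α / 2) * (j + 1)) * (1 - F u) := by
          rw [← mul_assoc, ← Real.exp_add]; ring_nf
  rw [div_le_iff₀ (hpos u), ← Real.exp_add]
  have hfl := Nat.floor_le ht
  have hfl' := Nat.lt_floor_add_one t
  calc 1 - F (u * Real.exp t) ≤ 1 - F (u * Real.exp ⌊t⌋₊) :=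
        sub_le_sub_left (hmono (by gcongr)) _
    _ ≤ Real.exp (-(α / 2) * ⌊t⌋₊) * (1 - F u) := hstep _
    _ ≤ Real.exp (α / 2 + -(α / 2) * t) * (1 - F u) := by
        have := (hpos u).le
        gcongr
        nlinarith

lemma integrableOn_potter_bound (hα : 0 < α) :
    IntegrableOn (fun t : ℝ => Real.exp (α / 2) * Real.exp (-(α / 2) * t)) (Set.Ioi 0) :=
  (integrableOn_exp_mul_Ioi (by linarith) 0).const_mul _

lemma measurable_tail_exp (hmono : Monotone F) (u : ℝ) :
    Measurable fun t : ℝ => 1 - F (u * Real.exp t) :=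
  measurable_const.sub (hmono.measurable.comp (by fun_prop))

/-- Dominated convergence under the Potter bound, with pointwise limit `e^{-αt}`. By
`integral_logPos` the numerator is the mean of `log⁺ (X/u)`. -/
lemma RegularlyVaryingTail.tendsto_integral (hRV : RegularlyVaryingTail F α) (hmono : Monotone F)
    (hle : ∀ x, F x ≤ 1) (hα : 0 < α) :
    Tendsto (fun u => (∫ t in Set.Ioi (0 : ℝ), (1 - F (u * Real.exp t))) / (1 - F u)) atTop
      (𝓝 (1 / α)) := by
  have hpos := hRV.tail_pos hmono hle
  have hlim : ∫ t in Set.Ioi (0 : ℝ), Real.exp (-α * t) = 1 / α := by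
    rw [integral_exp_mul_Ioi (by linarith) 0]
    simp
  rw [← hlim]
  simp_rw [← integral_div]
  refine tendsto_integral_filter_of_dominated_convergence
    (fun t : ℝ => Real.exp (α / 2) * Real.exp (-(α / 2) * t)) ?_ ?_
    (integrableOn_potter_bound hα) ?_
  · exact Eventually.of_forall fun u =>
      ((measurable_tail_exp hmono u).div_const _).aestronglyMeasurable
  · filter_upwards [hRV.tail_exp_le hmono hle hα] with u hu
    filter_upwards [ae_restrict_mem measurableSet_Ioi] with t ht
    rw [Real.norm_of_nonneg (div_nonneg (hpos _).le (hpos _).le)]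
    exact hu t (le_of_lt ht)
  · refine Eventually.of_forall fun t => ?_
    have := hRV (Real.exp t) (Real.exp_pos t)
    rwa [← Real.exp_mul, mul_comm t] at this

end RegularVariation

/-! ### From the distribution to the sample: the strong law -/

section Sampling

variable {Ω : Type*} [MeasurableSpace Ω] {P : Measure Ω} [IsProbabilityMeasure P]
  {X : ℕ → Ω → ℝ} {F : ℝ → ℝ} {α : ℝ}

lemma monotone_of_eq_cdf {Y : Ω → ℝ} (hF : ∀ x, P.real {ω | Y ω ≤ x} = F x) : Monotone F := by
  intro a b hab
  rw [← hF a, ← hF b]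
  exact measureReal_mono fun ω (hω : Y ω ≤ a) => hω.trans hab

lemma measureReal_lt {Y : Ω → ℝ} (hY : Measurable Y) (hF : ∀ x, P.real {ω | Y ω ≤ x} = F x)
    (x : ℝ) : P.real {ω | x < Y ω} = 1 - F x := by
  rw [← hF x, ← probReal_compl_eq_one_sub (measurableSet_le hY measurable_const)]
  congr 1
  ext ω
  simp

lemma measureReal_lt_log {Y : Ω → ℝ} (hY : Measurable Y)
    (hF : ∀ x, P.real {ω | Y ω ≤ x} = F x) (hY0 : ∀ᵐ ω ∂P, 0 < Y ω) {u t : ℝ} (hu : 0 < u)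
    (ht : 0 < t) :
    P.real {ω | t < max 0 (Real.log (Y ω / u))} = 1 - F (u * Real.exp t) := by
  rw [← measureReal_lt hY hF]
  refine measureReal_congr ?_
  filter_upwards [hY0] with ω hω
  refine propext ?_
  change t < max 0 (Real.log (Y ω / u)) ↔ u * Real.exp t < Y ω
  rw [lt_max_iff, or_iff_right ht.not_gt, Real.lt_log_iff_exp_lt (div_pos hω hu),
    lt_div_iff₀ hu, mul_comm]

lemma measurable_logPos (u : ℝ) : Measurable fun w : ℝ => max 0 (Real.log (w / u)) := by
  fun_prop

lemma integrable_logPos {Y : Ω → ℝ} (hY : Measurable Y)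
    (hF : ∀ x, P.real {ω | Y ω ≤ x} = F x) (hY0 : ∀ᵐ ω ∂P, 0 < Y ω) {u : ℝ} (hu : 0 < u)
    (hint : IntegrableOn (fun t => 1 - F (u * Real.exp t)) (Set.Ioi 0)) :
    Integrable (fun ω => max 0 (Real.log (Y ω / u))) P := by
  have hmeas : Measurable fun ω => max 0 (Real.log (Y ω / u)) := (measurable_logPos u).comp hY
  have hnn : ∀ ω, 0 ≤ max 0 (Real.log (Y ω / u)) := fun ω => le_max_left _ _
  rw [← lintegral_ofReal_ne_top_iff_integrable hmeas.aestronglyMeasurable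
    (Eventually.of_forall hnn), lintegral_eq_lintegral_meas_lt P (Eventually.of_forall hnn)
    hmeas.aemeasurable]
  have : ∫⁻ t in Set.Ioi 0, P {ω | t < max 0 (Real.log (Y ω / u))} =
      ∫⁻ t in Set.Ioi 0, ENNReal.ofReal (1 - F (u * Real.exp t)) := by
    refine setLIntegral_congr_fun measurableSet_Ioi fun t ht => ?_
    rw [← measureReal_lt_log hY hF hY0 hu ht, ofReal_measureReal]
  rw [this]
  exact hint.lintegral_lt_top.ne

lemma integral_logPos {Y : Ω → ℝ} (hY : Measurable Y)
    (hF : ∀ x, P.real {ω | Y ω ≤ x} = F x) (hY0 : ∀ᵐ ω ∂P, 0 < Y ω) {u : ℝ} (hu : 0 < u)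
    (hint : Integrable (fun ω => max 0 (Real.log (Y ω / u))) P) :
    ∫ ω, max 0 (Real.log (Y ω / u)) ∂P = ∫ t in Set.Ioi 0, (1 - F (u * Real.exp t)) := by
  rw [hint.integral_eq_integral_meas_lt (Eventually.of_forall fun ω => le_max_left _ _)]
  exact setIntegral_congr_fun measurableSet_Ioi fun t ht => measureReal_lt_log hY hF hY0 hu ht

lemma ae_tendsto_mean (hX : ∀ i, Measurable (X i)) (hindep : iIndepFun X P)
    (hF : ∀ i x, P.real {ω | X i ω ≤ x} = F x) {φ : ℝ → ℝ} (hφ : Measurable φ)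
    (hint : Integrable (fun ω => φ (X 0 ω)) P) :
    ∀ᵐ ω ∂P, Tendsto (fun n : ℕ => (∑ i : Fin n, φ (X i ω)) / n) atTop
      (𝓝 (∫ ω, φ (X 0 ω) ∂P)) := by
  have hid : ∀ i, IdentDistrib (X i) (X 0) P P := by
    refine fun i => ⟨(hX i).aemeasurable, (hX 0).aemeasurable, ?_⟩
    have := Measure.isProbabilityMeasure_map (μ := P) (hX i).aemeasurable
    refine Measure.ext_of_Iic _ _ fun a => ?_
    rw [Measure.map_apply (hX i) measurableSet_Iic, Measure.map_apply (hX 0) measurableSet_Iic,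
      ← measureReal_eq_measureReal_iff]
    exact (hF i a).trans (hF 0 a).symm
  have key := strong_law_ae_real (fun i ω => φ (X i ω)) hint
    (fun i j hij => (hindep.indepFun hij).comp hφ hφ) (fun i => (hid i).comp hφ)
  filter_upwards [key] with ω hω
  simpa only [Finset.sum_range] using hω

/-- The event that the exceedances over `u` among the first `n` observations look like a Pareto
sample of index `α`, at resolution `1 / m`. -/
def paretoLikeEvent {Ω : Type*} (X : ℕ → Ω → ℝ) (α u : ℝ) (m n : ℕ) : Set Ω :=
  {ω | (∀ j ∈ Finset.Icc 1 (2 * m),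
      |(exceedCount (fun i : Fin n => X i ω) (u * ((j : ℝ) / m) ^ (-α⁻¹)) : ℝ) /
        exceedCount (fun i : Fin n => X i ω) u - (j : ℝ) / m| < 1 / m) ∧
    |(∑ i : Fin n, max 0 (Real.log (X i ω / u))) / exceedCount (fun i : Fin n => X i ω) u
      - 1 / α| < 1 / (m * α)}

lemma measurable_exceedCount (hX : ∀ i, Measurable (X i)) (n : ℕ) (z : ℝ) :
    Measurable fun ω => (exceedCount (fun i : Fin n => X i ω) z : ℝ) := by
  simp_rw [exceedCount_eq_sum]
  exact Finset.measurable_sum _ fun i _ =>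
    (measurable_const.indicator measurableSet_Ioi).comp (hX i)

lemma measurableSet_paretoLikeEvent (hX : ∀ i, Measurable (X i)) (α u : ℝ) (m n : ℕ) :
    MeasurableSet (paretoLikeEvent X α u m n) := by
  have hc := measurable_exceedCount hX n
  refine MeasurableSet.inter ?_ ?_
  · refine measurableSet_setOfPred.2 (Measurable.forall fun j => Measurable.forall fun _ => ?_)
    refine measurableSet_setOfPred.1 ?_
    exact measurableSet_lt (((hc _).div (hc _)).sub_const _).abs measurable_const
  · refine measurableSet_lt (((Finset.measurable_sum _ fun i _ => ?_).div (hc _)).sub_const _).abs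
      measurable_const
    exact (measurable_logPos u).comp (hX i)

lemma exists_ae_eventually_paretoLikeEvent (hX : ∀ i, Measurable (X i)) (hindep : iIndepFun X P)
    (hF : ∀ i x, P.real {ω | X i ω ≤ x} = F x) (hpos : ∀ᵐ ω ∂P, 0 < X 0 ω) (hα : 0 < α)
    (hRV : RegularlyVaryingTail F α) {m : ℕ} (hm : 0 < m) :
    ∃ u : ℝ, 0 < u ∧ ∀ᵐ ω ∂P, ∀ᶠ n in atTop, ω ∈ paretoLikeEvent X α u m n := by
  have hmono := monotone_of_eq_cdf (hF 0)
  have hle : ∀ x, F x ≤ 1 := fun x => hF 0 x ▸ measureReal_le_one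
  have htail := hRV.tail_pos hmono hle
  have hm' : (0 : ℝ) < m := by exact_mod_cast hm
  have hgrid : ∀ᶠ u in atTop, ∀ j ∈ Finset.Icc 1 (2 * m),
      |(1 - F (u * ((j : ℝ) / m) ^ (-α⁻¹))) / (1 - F u) - (j : ℝ) / m| < 1 / m := by
    rw [Finset.eventually_all]
    intro j hj
    have hj0 : (0 : ℝ) < j := by exact_mod_cast (Finset.mem_Icc.1 hj).1
    have h1 := hRV (((j : ℝ) / m) ^ (-α⁻¹)) (by positivity)
    rw [← Real.rpow_mul (by positivity), neg_mul_neg, inv_mul_cancel₀ hα.ne',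
      Real.rpow_one] at h1
    simpa only [Real.dist_eq] using Metric.tendsto_nhds.1 h1 (1 / m) (by positivity)
  have hlog : ∀ᶠ u in atTop,
      |(∫ t in Set.Ioi (0 : ℝ), (1 - F (u * Real.exp t))) / (1 - F u) - 1 / α| < 1 / (m * α) := by
    simpa only [Real.dist_eq] using Metric.tendsto_nhds.1 (hRV.tendsto_integral hmono hle hα)
      (1 / (m * α)) (by positivity)
  -- From here `u` is fixed. The strict inequalities hold for the limits, hence eventually for the
  -- sample averages.
  obtain ⟨u, hu1, hu2, hu3, hu⟩ := (hgrid.and (hlog.and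
    ((hRV.tail_exp_le hmono hle hα).and (eventually_gt_atTop 0)))).exists
  refine ⟨u, hu, ?_⟩
  have hint : IntegrableOn (fun t => 1 - F (u * Real.exp t)) (Set.Ioi 0) := by
    refine ((integrableOn_potter_bound hα).mul_const (1 - F u)).mono'
      (measurable_tail_exp hmono u).aestronglyMeasurable ?_
    filter_upwards [ae_restrict_mem measurableSet_Ioi] with t ht
    rw [Real.norm_of_nonneg (htail _).le, ← div_le_iff₀ (htail u)]
    exact hu3 t (le_of_lt ht)
  have hint' := integrable_logPos (hX 0) (hF 0) hpos hu hint
  have hLlog := ae_tendsto_mean hX hindep hF (measurable_logPos u) hint'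
  rw [integral_logPos (hX 0) (hF 0) hpos hu hint'] at hLlog
  have hLcount : ∀ z, ∀ᵐ ω ∂P, Tendsto
      (fun n : ℕ => (exceedCount (fun i : Fin n => X i ω) z : ℝ) / n) atTop (𝓝 (1 - F z)) := by
    intro z
    have hmeas : Measurable ((Set.Ioi z).indicator fun _ => (1 : ℝ)) :=
      measurable_const.indicator measurableSet_Ioi
    have hset : MeasurableSet {ω | z < X 0 ω} := measurableSet_lt measurable_const (hX 0)
    have heq : (fun ω => (Set.Ioi z).indicator (fun _ => (1 : ℝ)) (X 0 ω)) =
        {ω | z < X 0 ω}.indicator fun _ => (1 : ℝ) := rfl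
    have h1 := ae_tendsto_mean hX hindep hF hmeas
      (by rw [heq]; exact (integrable_const _).indicator hset)
    rw [heq, integral_indicator_const _ hset, smul_eq_mul, mul_one,
      measureReal_lt (hX 0) (hF 0)] at h1
    simpa only [exceedCount_eq_sum] using h1
  have hdiv : ∀ {a b : ℕ → ℝ} {A B : ℝ}, B ≠ 0 → Tendsto (fun n : ℕ => a n / n) atTop (𝓝 A) →
      Tendsto (fun n : ℕ => b n / n) atTop (𝓝 B) → Tendsto (fun n => a n / b n) atTop
      (𝓝 (A / B)) := by
    intro a b A B hB ha hb
    refine (ha.div hb hB).congr' ?_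
    filter_upwards [eventually_gt_atTop 0] with n hn
    exact div_div_div_cancel_right₀ (by exact_mod_cast hn.ne') _ _
  have hLgrid := ae_all_iff.2 fun j : ℕ => hLcount (u * ((j : ℝ) / m) ^ (-α⁻¹))
  filter_upwards [hLlog, hLcount u, hLgrid] with ω h1 h2 h3
  refine Eventually.and ?_ ?_
  · rw [Finset.eventually_all]
    intro j hj
    exact ((hdiv (htail u).ne' (h3 j) h2).sub_const _).abs.eventually_lt_const (hu1 j hj)
  · exact ((hdiv (htail u).ne' h1 h2).sub_const _).abs.eventually_lt_const hu2

lemma lt_kappaStar_of_mem_paretoLikeEvent {Ω : Type*} {X : ℕ → Ω → ℝ} {α u : ℝ} {m n : ℕ} {ω : Ω} (hα : 0 < α) (hu : 0 < u)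
    (hm : 4 ≤ m) (hω : ∀ i, 0 < X i ω) (h : ω ∈ paretoLikeEvent X α u m n) {M : ℝ} (hM : 0 < M)
    (hMm : 14 * M < m) : M < kappaStar fun i : Fin n => X i ω := by
  obtain ⟨k, hk, hks⟩ := exists_ksDist_le hα (fun i : Fin n => hω i) hu hm h.1 h.2
  refine lt_kappaStar (fun i : Fin n => hω i) hk hM (hks.trans_lt ?_)
  rw [div_lt_div_iff₀ (by linarith) (by linarith)]
  linarith

end Sampling
end PLFit

theorem mainTheorem4 {Ω : Type*} [MeasurableSpace Ω] (P : Measure Ω) [IsProbabilityMeasure P]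
    (X : ℕ → Ω → ℝ) (hX : ∀ i, Measurable (X i)) (hindep : iIndepFun X P)
    (F : ℝ → ℝ) (hF : ∀ i x, P.real {ω | X i ω ≤ x} = F x)
    (hsupp : ∀ x : ℝ, x < 1 → F x = 0) (hcont : Continuous F)
    (α : ℝ) (hα : 0 < α) (hRV : PLFit.RegularlyVaryingTail F α) :
    PLFit.TendstoInProbabilityAtTop P
      (fun n ω => (PLFit.kappaStar (fun i : Fin n => X i ω) : ℝ)) := by
  intro M
  have hpos : ∀ᵐ ω ∂P, ∀ i, 0 < X i ω := by
    refine ae_all_iff.2 fun i => ?_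
    have h0 := (measureReal_eq_zero_iff).1 ((hF i 0).trans (hsupp 0 one_pos))
    simpa [ae_iff] using h0
  -- The factor `14` makes `7/m < 1/(2M)`; replacing `M` by `max M 1` keeps it positive.
  obtain ⟨m, hm⟩ := exists_nat_gt (max 4 (14 * max M 1))
  rw [max_lt_iff] at hm
  have hm4 : 4 ≤ m := by exact_mod_cast hm.1.le
  obtain ⟨u, hu, hev⟩ := PLFit.exists_ae_eventually_paretoLikeEvent hX hindep hF
    (hpos.mono fun ω h => h 0) hα hRV (m := m) (by omega)
  have hlim : Tendsto (fun n => P (PLFit.paretoLikeEvent X α u m n)ᶜ) atTop (𝓝 (P ∅)) := by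
    refine tendsto_measure_of_ae_tendsto_indicator_of_isFiniteMeasure atTop MeasurableSet.empty
      (fun n => (PLFit.measurableSet_paretoLikeEvent hX α u m n).compl) ?_
    filter_upwards [hev] with ω hω
    filter_upwards [hω] with n hn
    simp [hn]
  rw [measure_empty] at hlim
  -- Comparison with the complement of the Pareto-like event requires no measurability of
  -- `kappaStar`.
  refine tendsto_of_tendsto_of_tendsto_of_le_of_le tendsto_const_nhds hlim
    (fun _ => zero_le) fun n => measure_mono_ae ?_
  filter_upwards [hpos] with ω hω hle hmem
  have := PLFit.lt_kappaStar_of_mem_paretoLikeEvent hα hu hm4 hω hmem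
    (lt_max_of_lt_right one_pos) hm.2
  have hle' : (PLFit.kappaStar (fun i : Fin n => X i ω) : ℝ) ≤ M := hle
  linarith [le_max_left M 1]
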